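/- Let $A\in\mathbb{Z}^{m\times n}$. A \emph{$k$-row TU decomposition} of $A$ is a factorization $A=UW$ with $U\in\mathbb{Z}^{m\times k}$ and $W\in\{0,\pm1\}^{k\times n}$ totally unimodular (TU). A \emph{$k$-row affine TU decomposition} of $A$ is a representation $A=\tilde A+UW$ with $\tilde A\in\mathbb{Z}^{m\times n}$, $U\in\mathbb{Z}^{m\times k}$, $W\in\{0,\pm1\}^{k\times n}$ such that $\begin{bmatrix}\tilde A\\ W\end{bmatrix}$ is TU. The \emph{TU-dimension} (\emph{affine TU-dimension}) of $A$ is the minimum $k$ for which $A$ has a $k$-row TU decomposition (affine TU decomposition). Write $a_n^T=[1,2,\ldots,n]\in\mathbb{Z}^{1\times n}$. Then the following hold. (1) The affine TU-dimension of $a_n^T$ is nondecreasing in $n$ and is $\Theta(\sqrt n)$. (2) (Upper bound.) Let $n=\ell^2$ with $\ell\ge 1$, let $W\in\{0,1\}^{(2\ell-1)\times\ell^2}$ be the matrix whose columns form $\ell$ consecutive blocks of size $\ell$, whose first $\ell$ rows are $[I_\ell\ I_\ell\ \cdots\ I_\ell]$, and whose row $\ell+t$ ($1\le t\le \ell-1$)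 is $1$ on block $t+1$ and $0$ elsewhere, and let $u^T=[1,2,\ldots,\ell,\ell,2\ell,\ldots,\ell^2-\ell]\in\mathbb{Z}^{1\times(2\ell-1)}$. Then $a_n^T=u^TW$ is a $(2\ell-1)$-row TU decomposition. If $\tilde a^T$ is the first row of $W$, $W'$ is $W$ without its first row, and $u'$ is $u$ without its first entry, then $a_n^T=\tilde a^T+u'^TW'$ is a $(2\ell-2)$-row affine TU decomposition. In particular the TU-dimension of $a_n^T$ is at most $2\ell-1$ and its affine TU-dimension is at most $2\ell-2$. (3) (Lower bound.) If $a_n^T$ has a $k$-row TU decomposition, then $k^2+k+1\ge n$, and in particular $k\ge\sqrt n-1$. If $a_n^T$ has a $k$-row affine TU decomposition, then it has a $(k+1)$-row TU decomposition, and $k\ge\sqrt n-2$. (4) The master knapsack polytope can be modeled with $O(\sqrt n)$ integrality constraints: there is a constant $C$ such that for every $n\ge1$ there are $k\le C\sqrt n$ and $W\in\mathbb{Z}^{k\times n}$ such that for every $b\in\mathbb{Z}$, with $P=\{x\in[0,1]^n\mid\sum_{i=1}^n i\,x_i\le b\}$, $$\operatorname{conv}\Big(\Big\{x\in\{0,1\}^n\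 \Big|\ \sum_{i=1}^n i\,x_i\le b\Big\}\Big)=\operatorname{conv}(P\cap\mathbb{Z}^n)=\operatorname{conv}(\{x\in P\mid Wx\in\mathbb{Z}^k\}).$$ -/

import Mathlib

open scoped Matrix

/-- `A = Ã + U W` is an affine TU decomposition of the integer matrix `A`: the matrix obtained by
stacking `Ã` on top of `W` is totally unimodular (so `W` has entries in `{0, 1, -1}`). -/
def IsAffineTUDecomposition {m n k : ℕ} (A A' : Matrix (Fin m) (Fin n) ℤ)
    (U : Matrix (Fin m) (Fin k) ℤ) (W : Matrix (Fin k) (Fin n) ℤ) : Prop :=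
  A = A' + U * W ∧ (Matrix.fromRows A' W).IsTotallyUnimodular

/-- `A = U W` is a TU decomposition of the integer matrix `A`: the matrix `W` is totally
unimodular (so `W` has entries in `{0, 1, -1}`). -/
def IsTUDecomposition {m n k : ℕ} (A : Matrix (Fin m) (Fin n) ℤ)
    (U : Matrix (Fin m) (Fin k) ℤ) (W : Matrix (Fin k) (Fin n) ℤ) : Prop :=
  A = U * W ∧ W.IsTotallyUnimodular

/-- `A` admits a `k`-row affine TU decomposition. -/
def HasAffineTUDecomposition {m n : ℕ} (A : Matrix (Fin m) (Fin n) ℤ) (k : ℕ) : Prop :=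
  ∃ (A' : Matrix (Fin m) (Fin n) ℤ) (U : Matrix (Fin m) (Fin k) ℤ)
    (W : Matrix (Fin k) (Fin n) ℤ), IsAffineTUDecomposition A A' U W

/-- `A` admits a `k`-row TU decomposition. -/
def HasTUDecomposition {m n : ℕ} (A : Matrix (Fin m) (Fin n) ℤ) (k : ℕ) : Prop :=
  ∃ (U : Matrix (Fin m) (Fin k) ℤ) (W : Matrix (Fin k) (Fin n) ℤ), IsTUDecomposition A U W

theorem isTotallyUnimodular_one_int (n : ℕ) :
    (1 : Matrix (Fin n) (Fin n) ℤ).IsTotallyUnimodular := by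
  have h := Matrix.IsTotallyUnimodular.fromRows_unitlike
    (A := (0 : Matrix (Fin 0) (Fin n) ℤ)) (B := (1 : Matrix (Fin n) (Fin n) ℤ))
    (Matrix.emptyRows_isTotallyUnimodular _)
    (fun _ i => ⟨i, 1, by ext j; simp [Matrix.one_apply, Pi.single_apply, eq_comm]⟩)
  exact h.submatrix Sum.inr id

/-- Every matrix with `n` columns has an `n`-row TU decomposition, so that the minimum below is
over a nonempty set. -/
theorem hasTUDecomposition_self {m n : ℕ} (A : Matrix (Fin m) (Fin n) ℤ) :
    HasTUDecomposition A n :=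
  ⟨A, 1, by simp, isTotallyUnimodular_one_int n⟩

/-- Every matrix with `n` columns has an `n`-row affine TU decomposition, so that the minimum below
is over a nonempty set. -/
theorem hasAffineTUDecomposition_self {m n : ℕ} (A : Matrix (Fin m) (Fin n) ℤ) :
    HasAffineTUDecomposition A n := by
  refine ⟨0, A, 1, by simp, ?_⟩
  have h := Matrix.IsTotallyUnimodular.fromRows_unitlike
    (A := (1 : Matrix (Fin n) (Fin n) ℤ)) (B := (0 : Matrix (Fin m) (Fin n) ℤ))
    (isTotallyUnimodular_one_int n)
    (fun ⟨j⟩ _ => ⟨j, 0, by ext j; simp⟩)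
  have h2 := h.submatrix Sum.swap id
  convert h2 using 1
  ext i j
  rcases i with i | i <;> rfl

/-- The affine TU-dimension of `A`: the least `k` such that `A` admits a `k`-row affine TU
decomposition. -/
noncomputable def affineTUDim {m n : ℕ} (A : Matrix (Fin m) (Fin n) ℤ) : ℕ :=
  sInf {k | HasAffineTUDecomposition A k}

/-- The TU-dimension of `A`: the least `k` such that `A` admits a `k`-row TU decomposition. -/
noncomputable def tuDim {m n : ℕ} (A : Matrix (Fin m) (Fin n) ℤ) : ℕ :=
  sInf {k | HasTUDecomposition A k}

theorem hasAffineTUDecomposition_affineTUDim {m n : ℕ} (A : Matrix (Fin m) (Fin n) ℤ) :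
    HasAffineTUDecomposition A (affineTUDim A) :=
  Nat.sInf_mem (s := {k | HasAffineTUDecomposition A k}) ⟨n, hasAffineTUDecomposition_self A⟩

theorem hasTUDecomposition_tuDim {m n : ℕ} (A : Matrix (Fin m) (Fin n) ℤ) :
    HasTUDecomposition A (tuDim A) :=
  Nat.sInf_mem (s := {k | HasTUDecomposition A k}) ⟨n, hasTUDecomposition_self A⟩

/-- The master knapsack row `[1, 2, …, n]`, as a `1 × n` matrix. -/
def masterRow (n : ℕ) : Matrix (Fin 1) (Fin n) ℤ :=
  Matrix.of fun _ j => (j : ℤ) + 1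

/-- The entry in row `i` and column `j` (both counted from `0`) of the `(2ℓ-1) × ℓ²` matrix whose
columns form `ℓ` consecutive blocks of size `ℓ`: its first `ℓ` rows are `[I_ℓ I_ℓ … I_ℓ]`, and row
`ℓ + t` (for `t = 0, …, ℓ - 2`) is the indicator of the block with number `t + 1`. -/
def masterEntry (ℓ i j : ℕ) : ℤ :=
  if i < ℓ then (if j % ℓ = i then 1 else 0)
  else (if j / ℓ = i - ℓ + 1 then 1 else 0)

/-- The entry with number `i` (counted from `0`) of `[1, 2, …, ℓ, ℓ, 2ℓ, …, ℓ² - ℓ]`. -/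
def masterCoeff (ℓ i : ℕ) : ℤ :=
  if i < ℓ then (i : ℤ) + 1 else ((i : ℤ) - ℓ + 1) * ℓ

/-- The explicit `(2ℓ-1) × ℓ²` matrix `W`. -/
def masterW (ℓ : ℕ) : Matrix (Fin (2 * ℓ - 1)) (Fin (ℓ ^ 2)) ℤ :=
  Matrix.of fun i j => masterEntry ℓ i j

/-- The explicit row `u = [1, 2, …, ℓ, ℓ, 2ℓ, …, ℓ² - ℓ]`. -/
def masterU (ℓ : ℕ) : Matrix (Fin 1) (Fin (2 * ℓ - 1)) ℤ :=
  Matrix.of fun _ i => masterCoeff ℓ i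

/-- The first row of `masterW ℓ`. -/
def masterWHead (ℓ : ℕ) : Matrix (Fin 1) (Fin (ℓ ^ 2)) ℤ :=
  Matrix.of fun _ j => masterEntry ℓ 0 j

/-- `masterW ℓ` without its first row. -/
def masterWTail (ℓ : ℕ) : Matrix (Fin (2 * ℓ - 2)) (Fin (ℓ ^ 2)) ℤ :=
  Matrix.of fun i j => masterEntry ℓ (i + 1) j

/-- `masterU ℓ` without its first entry. -/
def masterUTail (ℓ : ℕ) : Matrix (Fin 1) (Fin (2 * ℓ - 2)) ℤ :=
  Matrix.of fun _ i => masterCoeff ℓ (i + 1)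

/-- The master knapsack polytope `conv {x ∈ {0,1}ⁿ | ∑ i xᵢ ≤ b}`. -/
def masterPolytope (n : ℕ) (b : ℤ) : Set (Fin n → ℝ) :=
  convexHull ℝ {x | (∀ i, x i = 0 ∨ x i = 1) ∧ ∑ i : Fin n, ((i : ℝ) + 1) * x i ≤ b}

/-- The linear relaxation `{x ∈ [0,1]ⁿ | ∑ i xᵢ ≤ b}`. -/
def masterRelaxation (n : ℕ) (b : ℤ) : Set (Fin n → ℝ) :=
  {x | (∀ i, 0 ≤ x i ∧ x i ≤ 1) ∧ ∑ i : Fin n, ((i : ℝ) + 1) * x i ≤ b}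

/-- The integer hull `conv (P ∩ ℤⁿ)`. -/
def integerHull {n : ℕ} (P : Set (Fin n → ℝ)) : Set (Fin n → ℝ) :=
  convexHull ℝ {x | x ∈ P ∧ ∀ i, ∃ z : ℤ, x i = z}

/-- The mixed integer hull `conv {x ∈ P | W x ∈ ℤᵏ}`. -/
def mixedIntegerHull {n k : ℕ} (P : Set (Fin n → ℝ)) (W : Matrix (Fin k) (Fin n) ℤ) :
    Set (Fin n → ℝ) :=
  convexHull ℝ {x | x ∈ P ∧ ∀ i, ∃ z : ℤ, (W.map (Int.cast : ℤ → ℝ) *ᵥ x) i = z}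

/-! Upper bound: counting columns from 0, write j = qℓ + r with r < ℓ, so that the entry is j + 1 =
(r + 1) + qℓ. One class of rows of `masterW` selects r, the other selects q > 0, and such two-class
incidence matrices are TU.

Lower bound: if two columns of `W` agreed up to sign, so would two entries of the positive, strictly
increasing row `U * W`. Heller's bound (`card_le`) therefore limits n. It comes from Sauer–Shelah:
column supports are pairwise distinct, and three shattered rows would contain a submatrix of
determinant ±2 (`false_of_fano`).

Polytope: the knapsack value of x depends only on `W x`. If `W x` is integral, total unimodularity
makes the fibre of `W` through x in the unit cube an integral polytope (`mem_convexHull`), so x is a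
convex combination of 0/1 points with the same knapsack value. -/

/-- A `0/1` matrix whose rows split into two classes such that each column has at most one `1` in
each class is totally unimodular. -/
theorem isTotallyUnimodular_of_bipartite {m n : Type*} (A : Matrix m n ℤ) (p : m → Bool)
    (h01 : ∀ i j, A i j = 0 ∨ A i j = 1)
    (hp : ∀ i i' j, p i = p i' → A i j = 1 → A i' j = 1 → i = i') :
    A.IsTotallyUnimodular := by
  intro k f g hf hg
  induction k with
  | zero => exact ⟨1, by simp⟩
  | succ k ih =>
    -- A column with at most one nonzero entry allows Laplace expansion. Otherwise every column has
    -- exactly two ones, one per class, and the signed sum of rows vanishes.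
    by_cases H : ∃ j i₀, ∀ i ≠ i₀, A (f i) (g j) = 0
    · obtain ⟨j, i₀, h0⟩ := H
      obtain ⟨s, hs⟩ := ih (f ∘ i₀.succAbove) (g ∘ j.succAbove)
        (hf.comp Fin.succAbove_right_injective) (hg.comp Fin.succAbove_right_injective)
      rw [Matrix.det_succ_column _ j, Finset.sum_eq_single i₀
        (fun i _ hi => by simp [h0 i hi]) (by simp), Matrix.submatrix_submatrix, ← hs,
        Matrix.submatrix_apply]
      rcases h01 (f i₀) (g j) with h | h <;> rw [h]
      · exact ⟨0, by simp⟩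
      · rcases neg_one_pow_eq_or ℤ (i₀ + j : ℕ) with e | e <;> rw [e]
        · exact ⟨s, by simp⟩
        · exact ⟨-s, by simp⟩
    · push Not at H
      refine ⟨0, ?_⟩
      rw [SignType.coe_zero, eq_comm, ← Matrix.exists_vecMul_eq_zero_iff]
      refine ⟨fun i => if p (f i) then 1 else -1, ?_, ?_⟩
      · intro h
        have := congrFun h 0
        simp only [Pi.zero_apply] at this
        split_ifs at this <;> omega
      · ext j
        obtain ⟨i₁, -, h₁⟩ := H j 0
        obtain ⟨i₂, hne, h₂⟩ := H j i₁
        have h₁ := (h01 _ _).resolve_left h₁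
        have h₂ := (h01 _ _).resolve_left h₂
        have hpp : p (f i₁) ≠ p (f i₂) := fun e => hne (hf (hp _ _ _ e h₁ h₂)).symm
        rw [Matrix.vecMul, dotProduct, ← Finset.sum_subset (Finset.subset_univ {i₁, i₂}),
          Finset.sum_pair hne.symm]
        · simp only [Matrix.submatrix_apply, h₁, h₂, Pi.zero_apply]
          cases h : p (f i₁) <;> cases h' : p (f i₂) <;> simp_all
        · intro i _ hi
          simp only [Finset.mem_insert, Finset.mem_singleton, not_or] at hi
          have : A (f i) (g j) = 0 := by
            refine (h01 _ _).resolve_right fun h => ?_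
            have e₁ : p (f i) ≠ p (f i₁) := fun e => hi.1 (hf (hp _ _ _ e h h₁))
            have e₂ : p (f i) ≠ p (f i₂) := fun e => hi.2 (hf (hp _ _ _ e h h₂))
            cases h : p (f i) <;> cases h' : p (f i₁) <;> cases h'' : p (f i₂) <;> simp_all
          simp [this]

/-! ### Forbidden submatrices and Heller's bound -/

theorem Matrix.IsTotallyUnimodular.eq_one_or_neg_one {m n : Type*} {W : Matrix m n ℤ}
    (hW : W.IsTotallyUnimodular) {i : m} {j : n} (h : W i j ≠ 0) : W i j = 1 ∨ W i j = -1 := by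
  obtain ⟨s, hs⟩ := hW.apply i j
  rw [← hs] at h ⊢
  cases s <;> simp_all

theorem SignType.intCast_cases (s : SignType) :
    (s : ℤ) = 0 ∨ (s : ℤ) = 1 ∨ (s : ℤ) = -1 := by
  cases s <;> simp

/-- In a totally unimodular matrix, a `2 × 2` submatrix without zeros is singular. -/
theorem Matrix.IsTotallyUnimodular.mul_eq_mul {m n : Type*} {W : Matrix m n ℤ}
    (hW : W.IsTotallyUnimodular) {i i' : m} {j j' : n} (h₁ : W i j ≠ 0) (h₂ : W i j' ≠ 0)
    (h₃ : W i' j ≠ 0) (h₄ : W i' j' ≠ 0) : W i j * W i' j' = W i j' * W i' j := by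
  obtain ⟨s, hs⟩ := W.isTotallyUnimodular_iff.1 hW 2 ![i, i'] ![j, j']
  have hs' := s.intCast_cases
  rw [hs, Matrix.det_fin_two] at hs'
  simp only [Matrix.submatrix_apply, Matrix.cons_val_zero, Matrix.cons_val_one] at hs'
  -- A 2 × 2 determinant with entries ±1 is 0 or ±2, and ±2 is excluded.
  rcases hW.eq_one_or_neg_one h₁ with e₁ | e₁ <;> rcases hW.eq_one_or_neg_one h₂ with e₂ | e₂ <;>
  rcases hW.eq_one_or_neg_one h₃ with e₃ | e₃ <;> rcases hW.eq_one_or_neg_one h₄ with e₄ | e₄ <;>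
  simp only [e₁, e₂, e₃, e₄] at hs' ⊢ <;> omega

/-- A totally unimodular matrix does not contain a signing of the matrix with columns
`111`, `110`, `101`, `011`. -/
theorem Matrix.IsTotallyUnimodular.false_of_fano {m n : Type*} {W : Matrix m n ℤ}
    (hW : W.IsTotallyUnimodular) {x y z : m} {a p q r : n}
    (ax : W x a ≠ 0) (ay : W y a ≠ 0) (az : W z a ≠ 0)
    (px : W x p ≠ 0) (py : W y p ≠ 0) (pz : W z p = 0)
    (qx : W x q ≠ 0) (qy : W y q = 0) (qz : W z q ≠ 0)
    (rx : W x r = 0) (ry : W y r ≠ 0) (rz : W z r ≠ 0) : False := by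
  have m₁ := hW.mul_eq_mul ax px ay py
  have m₂ := hW.mul_eq_mul ax qx az qz
  have m₃ := hW.mul_eq_mul ay ry az rz
  obtain ⟨s, hs⟩ := W.isTotallyUnimodular_iff.1 hW 3 ![x, y, z] ![p, q, r]
  have hs' := s.intCast_cases
  rw [hs, Matrix.det_fin_three] at hs'
  simp only [Matrix.submatrix_apply, Matrix.cons_val] at hs'
  rw [pz, qy, rx] at hs'
  -- The three singular 2 × 2 minors against column `a` force the two nonzero terms of the 3 × 3
  -- determinant to coincide, so it equals ±2.
  have key : W x p * W z q * W y r = W y p * W x q * W z r := by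
    have h0 : W x a * W y a * W z a ≠ 0 := by positivity
    apply mul_left_cancel₀ h0
    linear_combination (-(W z q * W x a) * (W y r * W z a)) * m₁
      + (W x a * W y p * W y r * W z a) * m₂ + (-(W x a * W y p * W x q * W z a)) * m₃
  have hu : IsUnit (W y p * W x q * W z r) := by
    simp only [IsUnit.mul_iff, Int.isUnit_iff]
    exact ⟨⟨hW.eq_one_or_neg_one py, hW.eq_one_or_neg_one qx⟩, hW.eq_one_or_neg_one rz⟩
  rw [Int.isUnit_iff] at hu
  have e : W x p * 0 * W z r - W x p * W y r * W z q - W x q * W y p * W z r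
      + W x q * W y r * 0 + 0 * W y p * W z q - 0 * 0 * 0 = -2 * (W y p * W x q * W z r) := by
    linear_combination -key
  rw [e] at hs'
  omega

/-- **Heller's bound** for matrices without equal or opposite columns. -/
theorem Matrix.IsTotallyUnimodular.card_le {k : ℕ} {ι : Type*} [Fintype ι]
    {W : Matrix (Fin k) ι ℤ} (hW : W.IsTotallyUnimodular)
    (hne : ∀ j j', (∀ i, W i j' = W i j) ∨ (∀ i, W i j' = -W i j) → j = j') :
    Fintype.card ι ≤ 1 + k + k.choose 2 := by
  classical
  set F : ι → Finset (Fin k) := fun j => {i | W i j ≠ 0} with hF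
  have memF : ∀ i j, i ∈ F j ↔ W i j ≠ 0 := by simp [hF]
  -- On a common support all 2 × 2 minors vanish, so the two columns are proportional with ratio ±1.
  have hinj : F.Injective := by
    intro j j' h
    have hz : ∀ i, W i j ≠ 0 ↔ W i j' ≠ 0 := fun i => by rw [← memF, ← memF, h]
    apply hne
    by_cases h0 : ∃ i₀, W i₀ j ≠ 0
    · obtain ⟨i₀, h0⟩ := h0
      have h0' := (hz i₀).1 h0
      have key : ∀ i, W i₀ j * W i j' = W i₀ j' * W i j := by
        intro i
        by_cases hi : W i j = 0
        · rw [hi, not_not.1 (mt (hz i).2 (not_not.2 hi))]; simp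
        · exact hW.mul_eq_mul h0 h0' hi ((hz i).1 hi)
      rcases hW.eq_one_or_neg_one h0 with e | e <;>
      rcases hW.eq_one_or_neg_one h0' with e' | e' <;> simp only [e, e'] at key
      · exact Or.inl fun i => by linarith [key i]
      · exact Or.inr fun i => by linarith [key i]
      · exact Or.inr fun i => by linarith [key i]
      · exact Or.inl fun i => by linarith [key i]
    · push Not at h0
      exact Or.inl fun i => by rw [h0 i, not_not.1 (mt (hz i).2 (not_not.2 (h0 i)))]
  set 𝒜 := Finset.univ.image F with h𝒜
  have hcard : 𝒜.card = Fintype.card ι := Finset.card_image_of_injective _ hinj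
  -- Shattering three rows would realise the traces 111, 110, 101 and 011.
  have hvc : 𝒜.vcDim ≤ 2 := by
    refine Finset.sup_le fun s hs => ?_
    by_contra hlt
    obtain ⟨t, hts, ht⟩ := Finset.exists_subset_card_eq (show 3 ≤ s.card by omega)
    have hsh := (Finset.mem_shatterer.1 hs).mono_right hts
    obtain ⟨x, y, z, hxy, hxz, hyz, rfl⟩ := Finset.card_eq_three.1 ht
    have get : ∀ u ⊆ ({x, y, z} : Finset (Fin k)), ∃ j, ∀ i ∈ ({x, y, z} : Finset (Fin k)),
        W i j ≠ 0 ↔ i ∈ u := by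
      intro u hu
      obtain ⟨v, hv, rfl⟩ := hsh hu
      obtain ⟨j, -, rfl⟩ := Finset.mem_image.1 hv
      exact ⟨j, fun i hi => by rw [Finset.mem_inter, memF]; tauto⟩
    obtain ⟨a, ha⟩ := get {x, y, z} (by simp)
    obtain ⟨p, hp⟩ := get {x, y} (by grind)
    obtain ⟨q, hq⟩ := get {x, z} (by grind)
    obtain ⟨r, hr⟩ := get {y, z} (by grind)
    refine hW.false_of_fano (x := x) (y := y) (z := z) (a := a) (p := p) (q := q) (r := r)
      ?_ ?_ ?_ ?_ ?_ ?_ ?_ ?_ ?_ ?_ ?_ ?_ <;> grind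
  calc Fintype.card ι = 𝒜.card := hcard.symm
    _ ≤ 𝒜.shatterer.card := 𝒜.card_le_card_shatterer
    _ ≤ ∑ d ∈ Finset.Iic 𝒜.vcDim, (Fintype.card (Fin k)).choose d :=
        Finset.card_shatterer_le_sum_vcDim
    _ ≤ ∑ d ∈ Finset.Iic 2, (Fintype.card (Fin k)).choose d :=
        Finset.sum_le_sum_of_subset (Finset.Iic_subset_Iic.2 hvc)
    _ = 1 + k + k.choose 2 := by
        rw [show Finset.Iic 2 = Finset.range 3 from rfl]
        simp [Finset.sum_range_succ]

/-! ### Integrality of fibres in the unit cube -/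

/-- A real matrix with injective action has an invertible square submatrix using all columns. -/
theorem Matrix.exists_isUnit_det_submatrix {m ι : Type*} [Fintype m] [Fintype ι] [DecidableEq ι]
    (M : Matrix m ι ℝ) (hM : ∀ d, M *ᵥ d = 0 → d = 0) :
    ∃ f : ι → m, IsUnit (M.submatrix f id).det := by
  have hrank : M.rank = Fintype.card ι := by
    rw [Matrix.rank, LinearMap.finrank_range_of_inj, Module.finrank_fintype_fun_eq_card]
    exact LinearMap.ker_eq_bot.1 (LinearMap.ker_eq_bot'.2 hM)
  rw [Matrix.rank_eq_finrank_span_row] at hrank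
  obtain ⟨g, hg, -, hli⟩ := Submodule.exists_fun_fin_finrank_span_eq ℝ (Set.range M.row)
  choose r hr using hg
  let e : ι ≃ Fin (Module.finrank ℝ (Submodule.span ℝ (Set.range M.row))) :=
    (Fintype.equivFin ι).trans (finCongr hrank.symm)
  refine ⟨r ∘ e, ?_⟩
  rw [← Matrix.isUnit_iff_isUnit_det, ← Matrix.linearIndependent_rows_iff_isUnit]
  have hrow : (M.submatrix (r ∘ e) id).row = g ∘ e := by
    ext i j
    exact congrFun (hr (e i)) j
  rw [hrow]
  exact hli.comp e e.injective

/-- If `W` is totally unimodular and acts injectively, then vectors with integral image are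
integral. -/
theorem Matrix.IsTotallyUnimodular.integral_of_injective {m ι : Type*} [Fintype m] [Fintype ι]
    {W : Matrix m ι ℤ} (hW : W.IsTotallyUnimodular)
    (hinj : ∀ d, W.map (Int.cast : ℤ → ℝ) *ᵥ d = 0 → d = 0) {y : ι → ℝ}
    (hy : ∀ i, ∃ z : ℤ, (W.map (Int.cast : ℤ → ℝ) *ᵥ y) i = z) (j : ι) : ∃ z : ℤ, y j = z := by
  classical
  obtain ⟨f, hf⟩ := Matrix.exists_isUnit_det_submatrix _ hinj
  choose z hz using hy
  set S : Matrix ι ι ℤ := W.submatrix f id with hS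
  have hSW : (W.map (Int.cast : ℤ → ℝ)).submatrix f id = S.map (Int.cast : ℤ → ℝ) := rfl
  have hdet : (S.map (Int.cast : ℤ → ℝ)).det = (S.det : ℝ) :=
    ((Int.castRingHom ℝ).map_det S).symm
  -- The determinant is nonzero and lies in {0, 1, -1}, so the inverse is integral.
  have hSu : IsUnit S.det := by
    rw [hSW, hdet, isUnit_iff_ne_zero, Int.cast_ne_zero] at hf
    obtain ⟨s, hs⟩ := (Matrix.isTotallyUnimodular_iff_fintype W).1 hW ι f id
    rw [Int.isUnit_iff, ← hs]
    rw [← hs] at hf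
    cases s <;> simp_all
  refine ⟨(S⁻¹ *ᵥ (z ∘ f)) j, ?_⟩
  have h1 : S.map (Int.cast : ℤ → ℝ) *ᵥ y = fun i => ((z (f i) : ℤ) : ℝ) := by
    ext i
    exact hz (f i)
  have h2 : (S⁻¹).map (Int.cast : ℤ → ℝ) * S.map (Int.cast : ℤ → ℝ) = 1 := by
    have := congrArg (fun B : Matrix ι ι ℤ => B.map (Int.castRingHom ℝ))
      (Matrix.nonsing_inv_mul S hSu)
    simp only [Matrix.map_mul] at this
    simpa using this
  have h3 : y = (S⁻¹).map (Int.cast : ℤ → ℝ) *ᵥ fun i => ((z (f i) : ℤ) : ℝ) := by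
    rw [← h1, Matrix.mulVec_mulVec, h2, Matrix.one_mulVec]
  rw [h3]
  simp [Matrix.mulVec, dotProduct]

/-- Points of the unit cube with integral image under a totally unimodular matrix are convex
combinations of `0/1` points with the same image. -/
theorem Matrix.IsTotallyUnimodular.mem_convexHull {m n : Type*} [Fintype m] [Fintype n]
    {W : Matrix m n ℤ} (hW : W.IsTotallyUnimodular) {x : n → ℝ}
    (hx01 : ∀ i, 0 ≤ x i ∧ x i ≤ 1)
    (hx : ∀ i, ∃ z : ℤ, (W.map (Int.cast : ℤ → ℝ) *ᵥ x) i = z) :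
    x ∈ convexHull ℝ {y | (∀ i, y i = 0 ∨ y i = 1) ∧
      W.map (Int.cast : ℤ → ℝ) *ᵥ y = W.map (Int.cast : ℤ → ℝ) *ᵥ x} := by
  classical
  set R := W.map (Int.cast : ℤ → ℝ) with hR
  set K : Set (n → ℝ) := Set.Icc 0 1 ∩ {y | R *ᵥ y = R *ᵥ x} with hK
  have hcont : Continuous fun y : n → ℝ => R *ᵥ y := by fun_prop
  have hKc : IsCompact K := isCompact_Icc.inter_right (isClosed_eq hcont continuous_const)
  have hKconv : Convex ℝ K := by
    refine (convex_Icc _ _).inter fun y hy z hz a b _ _ hab => ?_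
    simp only [Set.mem_ofPred_eq] at hy hz ⊢
    rw [Matrix.mulVec_add, Matrix.mulVec_smul, Matrix.mulVec_smul, hy, hz, ← add_smul, hab,
      one_smul]
  have hxK : x ∈ K := ⟨⟨fun i => (hx01 i).1, fun i => (hx01 i).2⟩, rfl⟩
  set T : Set (n → ℝ) := {y | (∀ i, y i = 0 ∨ y i = 1) ∧ R *ᵥ y = R *ᵥ x} with hT
  have hTfin : T.Finite := by
    refine (Set.Finite.pi' (t := fun _ : n => ({0, 1} : Set ℝ)) fun _ => by simp).subset ?_
    intro y hy i
    simpa using hy.1 i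
  have hext : K.extremePoints ℝ ⊆ T := by
    intro y hy
    obtain ⟨⟨⟨hy0, hy1⟩, hyR⟩, hext⟩ := hy
    refine ⟨?_, hyR⟩
    -- The unit rows of `D` record the tight bounds at `y`; its other rows are zero. Appending them
    -- preserves total unimodularity.
    set D : Matrix n n ℤ := Matrix.diagonal fun i => if y i = 0 ∨ y i = 1 then 1 else 0 with hD
    have hWD : (Matrix.fromRows W D).IsTotallyUnimodular := by
      refine hW.fromRows_unitlike fun _ i => ⟨i, if y i = 0 ∨ y i = 1 then 1 else 0, ?_⟩
      ext j
      rcases eq_or_ne i j with rfl | h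
      · simp only [hD, Matrix.diagonal_apply_eq, Pi.single_eq_same]
        split_ifs <;> simp
      · rw [hD, Matrix.diagonal_apply_ne _ h, Pi.single_eq_of_ne h.symm]
    have hmap : ∀ v : n → ℝ, (Matrix.fromRows W D).map (Int.cast : ℤ → ℝ) *ᵥ v =
        Sum.elim (R *ᵥ v) fun i => if y i = 0 ∨ y i = 1 then v i else 0 := by
      intro v
      ext (i | i)
      · rfl
      · change (D.map (Int.cast : ℤ → ℝ) *ᵥ v) i = if y i = 0 ∨ y i = 1 then v i else 0
        rw [hD, Matrix.diagonal_map Int.cast_zero, Matrix.mulVec_diagonal]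
        split_ifs <;> simp
    -- A kernel direction keeps the image under `R` and all tight coordinates, so `y` can move both
    -- ways along it inside `K`; extremality forces it to be zero.
    have hinj : ∀ d, (Matrix.fromRows W D).map (Int.cast : ℤ → ℝ) *ᵥ d = 0 → d = 0 := by
      intro d hd
      rw [hmap] at hd
      have hRd : R *ᵥ d = 0 := funext fun i => congrFun hd (Sum.inl i)
      have hd0 : ∀ i, y i = 0 ∨ y i = 1 → d i = 0 := fun i hi => by
        have := congrFun hd (Sum.inr i)
        simpa [hi] using this
      have hev : ∀ᶠ ε in nhdsWithin (0 : ℝ) (Set.Ioi 0),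
          ∀ i, (0 ≤ y i + ε * d i ∧ y i + ε * d i ≤ 1) ∧
            (0 ≤ y i - ε * d i ∧ y i - ε * d i ≤ 1) := by
        refine Filter.eventually_all.2 fun i => ?_
        have h0 : 0 ≤ y i := hy0 i
        have h1 : y i ≤ 1 := hy1 i
        by_cases hi : y i = 0 ∨ y i = 1
        · simp [hd0 i hi, h0, h1]
        · push Not at hi
          have h0 := lt_of_le_of_ne h0 hi.1.symm
          have h1 := lt_of_le_of_ne h1 hi.2
          have t₁ : Filter.Tendsto (fun ε : ℝ => y i + ε * d i) (nhds 0) (nhds (y i)) := by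
            have : Continuous fun ε : ℝ => y i + ε * d i := by fun_prop
            simpa using this.tendsto 0
          have t₂ : Filter.Tendsto (fun ε : ℝ => y i - ε * d i) (nhds 0) (nhds (y i)) := by
            have : Continuous fun ε : ℝ => y i - ε * d i := by fun_prop
            simpa using this.tendsto 0
          have hI := Icc_mem_nhds h0 h1
          exact nhdsWithin_le_nhds ((t₁.eventually_mem hI).and (t₂.eventually_mem hI))
      obtain ⟨ε, hε, hεpos⟩ := (hev.and self_mem_nhdsWithin).exists
      have hεpos : (0 : ℝ) < ε := hεpos
      have key : y + ε • d = y := by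
        refine hext (x₁ := y + ε • d) ⟨⟨fun i => (hε i).1.1, fun i => (hε i).1.2⟩, ?_⟩
          (x₂ := y - ε • d) ⟨⟨fun i => (hε i).2.1, fun i => (hε i).2.2⟩, ?_⟩ ?_
        · simpa [Matrix.mulVec_add, Matrix.mulVec_smul, hRd] using hyR
        · simpa [Matrix.mulVec_sub, Matrix.mulVec_smul, hRd] using hyR
        · refine ⟨1 / 2, 1 / 2, by norm_num, by norm_num, by norm_num, ?_⟩
          ext i
          simp only [Pi.add_apply, Pi.sub_apply, Pi.smul_apply, smul_eq_mul]
          ring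
      have := add_eq_left.1 key
      exact (smul_eq_zero.1 this).resolve_left hεpos.ne'
    intro i
    obtain ⟨z, hz⟩ := hWD.integral_of_injective hinj (y := y) (by
      rw [hmap]
      rintro (i | i)
      · rw [Sum.elim_inl, hyR]
        exact hx i
      · rw [Sum.elim_inr]
        split_ifs with h
        · rcases h with h | h
          · exact ⟨0, by simpa using h⟩
          · exact ⟨1, by simpa using h⟩
        · exact ⟨0, by simp⟩) i
    have h0 : 0 ≤ y i := hy0 i
    have h1 : y i ≤ 1 := hy1 i
    rw [hz] at h0 h1 ⊢
    have h0 : 0 ≤ z := by exact_mod_cast h0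
    have h1 : z ≤ 1 := by exact_mod_cast h1
    norm_cast
    omega
  -- Krein–Milman; the hull of the finite set `T` is already closed.
  have h := closure_convexHull_extremePoints hKc hKconv
  rw [← h] at hxK
  exact closure_minimal (convexHull_mono hext) (hTfin.isClosed_convexHull (𝕜 := ℝ)) hxK

/-! ### The explicit decompositions -/

theorem masterW_isTotallyUnimodular (ℓ : ℕ) : (masterW ℓ).IsTotallyUnimodular := by
  refine isTotallyUnimodular_of_bipartite _ (fun i => decide ((i : ℕ) < ℓ)) ?_ ?_
  · intro i j
    simp only [masterW, masterEntry, Matrix.of_apply]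
    split_ifs <;> simp
  · intro i i' j hp h h'
    simp only [masterW, masterEntry, Matrix.of_apply, decide_eq_decide] at hp h h'
    apply Fin.ext
    by_cases hi : (i : ℕ) < ℓ
    · rw [if_pos hi] at h
      rw [if_pos (hp.1 hi)] at h'
      split_ifs at h h' <;> omega
    · rw [if_neg hi] at h
      rw [if_neg (mt hp.2 hi)] at h'
      split_ifs at h h' <;> omega

theorem isTUDecomposition_master {ℓ : ℕ} (hℓ : 1 ≤ ℓ) :
    IsTUDecomposition (masterRow (ℓ ^ 2)) (masterU ℓ) (masterW ℓ) := by
  refine ⟨?_, masterW_isTotallyUnimodular ℓ⟩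
  ext i j
  obtain ⟨t, rfl⟩ : ∃ t, ℓ = t + 1 := ⟨ℓ - 1, by omega⟩
  simp only [masterRow, masterU, masterW, Matrix.mul_apply, Matrix.of_apply]
  rw [Fin.sum_univ_eq_sum_range
    (fun r => masterCoeff (t + 1) r * masterEntry (t + 1) r j) (2 * (t + 1) - 1),
    show 2 * (t + 1) - 1 = t + 1 + t by omega, Finset.sum_range_add]
  have hj : (j : ℕ) % (t + 1) < t + 1 := Nat.mod_lt _ (by omega)
  have h₁ : ∑ r ∈ Finset.range (t + 1), masterCoeff (t + 1) r * masterEntry (t + 1) r j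
      = ((j : ℕ) % (t + 1) : ℕ) + 1 := by
    rw [Finset.sum_eq_single ((j : ℕ) % (t + 1))]
    · simp [masterCoeff, masterEntry, hj]
    · intro r hr hne
      rw [masterEntry, if_pos (Finset.mem_range.1 hr), if_neg hne.symm, mul_zero]
    · intro h
      exact absurd (Finset.mem_range.2 hj) h
  have hq : (j : ℕ) / (t + 1) < t + 1 := by
    rw [Nat.div_lt_iff_lt_mul (by omega), ← pow_two]
    exact j.2
  have h₂ : ∑ r ∈ Finset.range t, masterCoeff (t + 1) (t + 1 + r)
        * masterEntry (t + 1) (t + 1 + r) j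
      = (((j : ℕ) / (t + 1) : ℕ) : ℤ) * (t + 1 : ℕ) := by
    have e : ∀ r, masterCoeff (t + 1) (t + 1 + r) * masterEntry (t + 1) (t + 1 + r) j
        = if (j : ℕ) / (t + 1) = r + 1 then ((r : ℤ) + 1) * (t + 1 : ℕ) else 0 := by
      intro r
      rw [masterCoeff, masterEntry, if_neg (by omega), if_neg (by omega), Nat.add_sub_cancel_left]
      split_ifs
      · push_cast
        ring
      · simp
    simp only [e]
    -- Block 0 has no indicator row and contributes 0.
    rcases h : (j : ℕ) / (t + 1) with _ | q
    · simp
    · rw [Finset.sum_eq_single q]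
      · simp
      · intro r _ hne
        rw [if_neg (by omega)]
      · intro hmem
        rw [Finset.mem_range] at hmem
        omega
  rw [h₁, h₂]
  have := Nat.mod_add_div (j : ℕ) (t + 1)
  zify at this ⊢
  linarith

theorem isAffineTUDecomposition_master {ℓ : ℕ} (hℓ : 1 ≤ ℓ) :
    IsAffineTUDecomposition (masterRow (ℓ ^ 2)) (masterWHead ℓ) (masterUTail ℓ)
      (masterWTail ℓ) := by
  constructor
  · rw [(isTUDecomposition_master hℓ).1]
    ext i j
    simp only [masterU, masterW, masterWHead, masterUTail, masterWTail, Matrix.mul_apply,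
      Matrix.add_apply, Matrix.of_apply]
    rw [Fin.sum_univ_eq_sum_range (fun r => masterCoeff ℓ r * masterEntry ℓ r j) (2 * ℓ - 1),
      Fin.sum_univ_eq_sum_range (fun r => masterCoeff ℓ (r + 1) * masterEntry ℓ (r + 1) j)
        (2 * ℓ - 2), show 2 * ℓ - 1 = 2 * ℓ - 2 + 1 by omega, Finset.sum_range_succ', add_comm]
    congr 1
    rw [masterCoeff, if_pos (by omega)]
    simp
  · have h := (masterW_isTotallyUnimodular ℓ).submatrix
      (Sum.elim (fun _ : Fin 1 => (⟨0, by omega⟩ : Fin (2 * ℓ - 1)))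
        fun i : Fin (2 * ℓ - 2) => ⟨i + 1, by omega⟩) id
    convert h using 1
    ext (i | i) j <;> rfl

/-! ### Lower bound, monotonicity and growth -/

theorem HasTUDecomposition.masterRow_le {n k : ℕ} (h : HasTUDecomposition (masterRow n) k) :
    n ≤ k ^ 2 + k + 1 := by
  obtain ⟨U, W, hA, hW⟩ := h
  have hcol : ∀ j : Fin n, (j : ℤ) + 1 = ∑ i, U 0 i * W i j := fun j => by
    rw [← Matrix.mul_apply, ← hA]
    rfl
  have h := hW.card_le (fun j j' hjj => by
    have e := hcol j
    have e' := hcol j'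
    apply Fin.ext
    rcases hjj with h | h <;> simp only [h, mul_neg, Finset.sum_neg_distrib] at e' <;> omega)
  rw [Fintype.card_fin, Nat.choose_two_right] at h
  have h2 : k * (k - 1) / 2 ≤ k ^ 2 := by
    rw [pow_two]
    exact (Nat.div_le_self _ _).trans (Nat.mul_le_mul_left _ (by omega))
  omega

theorem HasTUDecomposition.sqrt_le {n k : ℕ} (h : HasTUDecomposition (masterRow n) k) :
    √(n : ℝ) ≤ k + 1 := by
  rw [Real.sqrt_le_left (by positivity)]
  have := h.masterRow_le
  have : n ≤ (k + 1) ^ 2 := by nlinarith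
  exact_mod_cast this

/-- For a one-row matrix, the affine part can be moved into the factorization. -/
theorem HasAffineTUDecomposition.hasTUDecomposition_succ {n k : ℕ} {A : Matrix (Fin 1) (Fin n) ℤ}
    (h : HasAffineTUDecomposition A k) : HasTUDecomposition A (k + 1) := by
  obtain ⟨A', U, W, hA, hT⟩ := h
  refine ⟨Matrix.of fun _ => Fin.cons 1 (U 0), Matrix.of (Fin.cons (A' 0) W), ?_, ?_⟩
  · rw [hA]
    ext i j
    obtain rfl := Subsingleton.elim i 0
    simp only [Matrix.add_apply, Matrix.mul_apply, Matrix.of_apply, Fin.sum_univ_succ, Fin.cons_zero,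
      Fin.cons_succ, one_mul]
    rfl
  · have h := hT.submatrix (Fin.cons (Sum.inl 0) Sum.inr : Fin (k + 1) → Fin 1 ⊕ Fin k) id
    convert h using 1
    ext i j
    refine Fin.cases ?_ (fun i => ?_) i <;> rfl

theorem masterRow_submatrix {n n' : ℕ} (h : n ≤ n') :
    (masterRow n').submatrix id (Fin.castLE h) = masterRow n := rfl

theorem affineTUDim_masterRow_mono : Monotone fun n : ℕ => affineTUDim (masterRow n) := by
  intro n n' h
  obtain ⟨A', U, W, hA, hT⟩ := hasAffineTUDecomposition_affineTUDim (masterRow n')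
  -- Deleting trailing columns keeps `U` and total unimodularity.
  refine Nat.sInf_le ⟨A'.submatrix id (Fin.castLE h), U, W.submatrix id (Fin.castLE h), ?_, ?_⟩
  · exact congrArg (fun B => B.submatrix id (Fin.castLE h)) hA
  · have := hT.submatrix id (Fin.castLE h)
    convert this using 1
    ext (i | i) j <;> rfl

theorem exists_sq_ge {n : ℕ} (hn : 1 ≤ n) :
    ∃ ℓ : ℕ, 1 ≤ ℓ ∧ n ≤ ℓ ^ 2 ∧ (ℓ : ℝ) ≤ √(n : ℝ) + 1 := by
  refine ⟨⌈√(n : ℝ)⌉₊, ?_, ?_, (Nat.ceil_lt_add_one (Real.sqrt_nonneg _)).le⟩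
  · rw [Nat.one_le_ceil_iff, Real.sqrt_pos]
    exact_mod_cast hn
  · have := Real.sqrt_le_left (by positivity) |>.1 (Nat.le_ceil √(n : ℝ))
    exact_mod_cast this

theorem affineTUDim_masterRow_isTheta : Asymptotics.IsTheta Filter.atTop
    (fun n : ℕ => (affineTUDim (masterRow n) : ℝ)) (fun n : ℕ => √(n : ℝ)) := by
  constructor
  -- Rounding up to a square gives dimension ≤ 2ℓ - 2 with ℓ ≤ √n + 1, hence at most 2√n.
  · refine Asymptotics.IsBigO.of_bound 2 (Filter.eventually_atTop.2 ⟨1, fun n hn => ?_⟩)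
    obtain ⟨ℓ, hℓ, hnℓ, hle⟩ := exists_sq_ge hn
    have h := (affineTUDim_masterRow_mono hnℓ).trans
      (Nat.sInf_le ⟨_, _, _, isAffineTUDecomposition_master hℓ⟩)
    have h' : affineTUDim (masterRow n) + 2 ≤ 2 * ℓ := by
      simp only at h
      omega
    have h' : (affineTUDim (masterRow n) : ℝ) + 2 ≤ 2 * ℓ := by exact_mod_cast h'
    rw [Real.norm_of_nonneg (by positivity), Real.norm_of_nonneg (by positivity)]
    linarith
  -- The dimension is at least √n - 2, which is at least √n / 2 once n ≥ 16.
  · refine Asymptotics.IsBigO.of_bound 2 (Filter.eventually_atTop.2 ⟨16, fun n hn => ?_⟩)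
    have h := (hasAffineTUDecomposition_affineTUDim (masterRow n)).hasTUDecomposition_succ.sqrt_le
    have h4 : (4 : ℝ) ≤ √(n : ℝ) := by
      apply Real.le_sqrt_of_sq_le
      norm_num
      exact_mod_cast hn
    rw [Real.norm_of_nonneg (by positivity), Real.norm_of_nonneg (by positivity)]
    push_cast at h
    linarith

/-! ### Modelling the master knapsack polytope -/

theorem masterPolytope_eq_integerHull (n : ℕ) (b : ℤ) :
    masterPolytope n b = integerHull (masterRelaxation n b) := by
  unfold masterPolytope integerHull masterRelaxation
  congr 1
  ext x
  constructor
  · rintro ⟨h, hb⟩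
    refine ⟨⟨fun i => ?_, hb⟩, fun i => ?_⟩
    · rcases h i with h | h <;> rw [h] <;> norm_num
    · rcases h i with h | h
      · exact ⟨0, by simpa using h⟩
      · exact ⟨1, by simpa using h⟩
  · rintro ⟨⟨h, hb⟩, hz⟩
    refine ⟨fun i => ?_, hb⟩
    obtain ⟨z, hz⟩ := hz i
    obtain ⟨h0, h1⟩ := h i
    rw [hz] at h0 h1 ⊢
    have h0 : 0 ≤ z := by exact_mod_cast h0
    have h1 : z ≤ 1 := by exact_mod_cast h1
    norm_cast
    omega

/-- The factor `W` of a TU decomposition of `[1, 2, …, n]` models the master knapsack polytope. -/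
theorem IsTUDecomposition.masterPolytope_eq {n k : ℕ} {U : Matrix (Fin 1) (Fin k) ℤ}
    {W : Matrix (Fin k) (Fin n) ℤ} (h : IsTUDecomposition (masterRow n) U W) (b : ℤ) :
    masterPolytope n b = mixedIntegerHull (masterRelaxation n b) W := by
  have hsum : ∀ x : Fin n → ℝ, ∑ i : Fin n, ((i : ℝ) + 1) * x i =
      (U.map (Int.cast : ℤ → ℝ) *ᵥ (W.map (Int.cast : ℤ → ℝ) *ᵥ x)) 0 := by
    intro x
    have e : U.map (Int.cast : ℤ → ℝ) * W.map (Int.cast : ℤ → ℝ) =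
        (masterRow n).map (Int.cast : ℤ → ℝ) := by
      rw [h.1]
      exact (Matrix.map_mul (f := Int.castRingHom ℝ)).symm
    rw [Matrix.mulVec_mulVec, e]
    simp [Matrix.mulVec, dotProduct, masterRow]
  apply subset_antisymm
  · rw [masterPolytope_eq_integerHull]
    refine convexHull_mono ?_
    rintro x ⟨hx, hz⟩
    refine ⟨hx, fun i => ?_⟩
    choose z hz using hz
    refine ⟨(W *ᵥ z) i, ?_⟩
    simp [Matrix.mulVec, dotProduct, hz]
  · refine convexHull_min ?_ (convex_convexHull ℝ _)
    rintro x ⟨⟨h01, hb⟩, hz⟩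
    -- The 0/1 points share `W x`, hence the knapsack value, so they remain feasible.
    refine convexHull_mono ?_ (h.2.mem_convexHull h01 hz)
    rintro y ⟨hy, hyx⟩
    refine ⟨hy, ?_⟩
    rwa [hsum, hyx, ← hsum]

theorem mainTheorem9 :
    -- the affine TU-dimension of `[1, 2, …, n]` is nondecreasing in `n` and is `Θ(√n)`
    Monotone (fun n : ℕ => affineTUDim (masterRow n)) ∧
    Asymptotics.IsTheta Filter.atTop
      (fun n : ℕ => (affineTUDim (masterRow n) : ℝ)) (fun n : ℕ => √(n : ℝ)) ∧
    -- upper bound: the explicit decompositions for `n = ℓ²`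
    (∀ ℓ : ℕ, 1 ≤ ℓ →
      IsTUDecomposition (masterRow (ℓ ^ 2)) (masterU ℓ) (masterW ℓ) ∧
      IsAffineTUDecomposition (masterRow (ℓ ^ 2)) (masterWHead ℓ) (masterUTail ℓ)
        (masterWTail ℓ) ∧
      tuDim (masterRow (ℓ ^ 2)) ≤ 2 * ℓ - 1 ∧
      affineTUDim (masterRow (ℓ ^ 2)) ≤ 2 * ℓ - 2) ∧
    -- lower bound, for TU decompositions and for affine TU decompositions
    (∀ n k : ℕ, HasTUDecomposition (masterRow n) k →
      n ≤ k ^ 2 + k + 1 ∧ √(n : ℝ) - 1 ≤ (k : ℝ)) ∧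
    (∀ n k : ℕ, HasAffineTUDecomposition (masterRow n) k →
      HasTUDecomposition (masterRow n) (k + 1) ∧ √(n : ℝ) - 2 ≤ (k : ℝ)) ∧
    -- the master knapsack polytope is modeled by `O(√n)` integrality constraints
    (∃ C : ℝ, ∀ n : ℕ, 1 ≤ n →
      ∃ (k : ℕ) (W : Matrix (Fin k) (Fin n) ℤ), (k : ℝ) ≤ C * √(n : ℝ) ∧
        ∀ b : ℤ,
          integerHull (masterRelaxation n b) = mixedIntegerHull (masterRelaxation n b) W ∧
          masterPolytope n b = mixedIntegerHull (masterRelaxation n b) W) := by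
  refine ⟨affineTUDim_masterRow_mono, affineTUDim_masterRow_isTheta, fun ℓ hℓ =>
    ⟨isTUDecomposition_master hℓ, isAffineTUDecomposition_master hℓ,
      Nat.sInf_le ⟨_, _, isTUDecomposition_master hℓ⟩,
      Nat.sInf_le ⟨_, _, _, isAffineTUDecomposition_master hℓ⟩⟩,
    fun n k h => ⟨h.masterRow_le, by linarith [h.sqrt_le]⟩,
    fun n k h => ⟨h.hasTUDecomposition_succ, ?_⟩, 4, fun n hn => ?_⟩
  · have := h.hasTUDecomposition_succ.sqrt_le
    push_cast at this
    linarith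
  · obtain ⟨ℓ, hℓ, hnℓ, hle⟩ := exists_sq_ge hn
    have hdec : IsTUDecomposition (masterRow n) (masterU ℓ)
        ((masterW ℓ).submatrix id (Fin.castLE hnℓ)) := by
      refine ⟨?_, (masterW_isTotallyUnimodular ℓ).submatrix _ _⟩
      rw [← masterRow_submatrix hnℓ, (isTUDecomposition_master hℓ).1]
      rfl
    refine ⟨2 * ℓ - 1, (masterW ℓ).submatrix id (Fin.castLE hnℓ), ?_, fun b =>
      ⟨(masterPolytope_eq_integerHull n b).symm.trans (hdec.masterPolytope_eq b),
        hdec.masterPolytope_eq b⟩⟩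
    have h1 : (1 : ℝ) ≤ √(n : ℝ) := by
      apply Real.le_sqrt_of_sq_le
      norm_num
      exact_mod_cast hn
    -- The constant 4 arises from 2ℓ ≤ 2√n + 2 ≤ 4√n.
    have hk : ((2 * ℓ - 1 : ℕ) : ℝ) ≤ 2 * ℓ := by
      exact_mod_cast Nat.sub_le _ _
    linarith
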